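/- Let $G$ be any finite set of finite sets; $G$ need not be a simplicial complex, and the empty set may be an element of $G$. Let $K$ be an (associative, not necessarily commutative) division ring and let $h: G \to K$ be any function. For $A \subseteq G$ put $\chi(A)=\sum_{x\in A} h(x)$, and for $x \in G$ put $W^-(x)=\{z\in G : z\subseteq x\}$, $W^+(x)=\{z\in G : x\subseteq z\}$ and $\omega(x)=(-1)^{\dim(x)}$ with $\dim(x)=|x|-1$. Define the $G\times G$ matrices $L(x,y)=\chi(W^-(x)\cap W^-(y))$ (connection matrix) and $g(x,y)=\omega(x)\,\omega(y)\,\chi(W^+(x)\cap W^+(y))$ (Green matrix) over $K$. Let $\det$ be the Dieudonné determinant of square matrices over $K$, with values in $(K^\times/[K^\times,K^\times])\cup\{0\}$, and for $a\in K$ let $[a]$ be the class of $a$ in this set, with $[0]=0$. Then, for every enumeration of $G$ used to order the rows and columns, $$\det(L)=\det(g)=\prod_{x\in G}[h(x)].$$ -/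

import Mathlib

open scoped Classical in
/-- The canonical multiplicative map `K → (Kˣ)ᵃᵇ ∪ {0}` of a division ring: it sends `0` to `0` and
a unit to its class modulo the commutator subgroup of `Kˣ`. -/
noncomputable def abClass {K : Type*} [DivisionRing K] : K →*₀ WithZero (Abelianization Kˣ) :=
  (WithZero.map' (Abelianization.of (G := Kˣ))).comp
    (WithZero.withZeroUnitsEquiv (G := K)).symm.toMonoidWithZeroHom

open scoped Classical in
/-- The Dieudonné determinant of an `n × n` matrix over a division ring `K`, with values in
`(Kˣ)ᵃᵇ ∪ {0}`, by row elimination. If the first column is zero, the determinant is `0`. Otherwise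
let `p` be the first row with `A p 0 ≠ 0`. Subtracting left multiples of row `p` from the other rows
(which does not change the determinant) clears the rest of the first column; moving row `p` to the
top costs `(-1) ^ p`, and what remains is the pivot `A p 0` times the determinant of the matrix
`A i j - A i 0 * (A p 0)⁻¹ * A p j` with `i ≠ p` and `j ≠ 0`. This is the unique map that is
invariant under adding a left multiple of a row to another row, is multiplied by the class of `c`
when a row is multiplied by `c` from the left, and is `1` at the identity matrix. -/
noncomputable def dieudonneDet {K : Type*} [DivisionRing K] :
    {n : ℕ} → Matrix (Fin n) (Fin n) K → WithZero (Abelianization Kˣ)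
  | 0, _ => 1
  | _ + 1, A =>
    if hA : ∃ i, A i 0 ≠ 0 then
      let p := Fin.find (fun i => A i 0 ≠ 0) hA
      abClass ((-1) ^ (p : ℕ) * A p 0) *
        dieudonneDet (Matrix.of fun i j =>
          A (p.succAbove i) j.succ - A (p.succAbove i) 0 * (A p 0)⁻¹ * A p j.succ)
    else 0

section SetsOfSets

variable {α : Type*} [DecidableEq α] {G : Finset (Finset α)} {K : Type*} [DivisionRing K]

/-- `χ(A) = ∑_{x ∈ A} h(x)` for a subset `A` of `G`. -/
def chi (h : G → K) (A : Finset G) : K := ∑ x ∈ A, h x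

/-- `W⁻(x) = {z ∈ G | z ⊆ x}`. -/
def Wminus (x : G) : Finset G := Finset.univ.filter fun z => z.1 ⊆ x.1

/-- `W⁺(x) = {z ∈ G | x ⊆ z}`. -/
def Wplus (x : G) : Finset G := Finset.univ.filter fun z => x.1 ⊆ z.1

/-- `dim(x) = |x| - 1`, an integer; the empty set has dimension `-1`. -/
def setDim (x : Finset α) : ℤ := (x.card : ℤ) - 1

/-- `ω(x) = (-1) ^ dim(x)`, as an element of `K`. -/
def signOmega (K : Type*) [DivisionRing K] (x : Finset α) : K := (-1) ^ setDim x

/-- The connection matrix `L(x, y) = χ(W⁻(x) ∩ W⁻(y))`. -/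
def connectionMatrix (h : G → K) : Matrix G G K :=
  Matrix.of fun x y => chi h (Wminus x ∩ Wminus y)

/-- The Green matrix `g(x, y) = ω(x) ω(y) χ(W⁺(x) ∩ W⁺(y))`. -/
def greenMatrix (h : G → K) : Matrix G G K :=
  Matrix.of fun x y => signOmega K x.1 * signOmega K y.1 * chi h (Wplus x ∩ Wplus y)

end SetsOfSets

/-! ### Row operations and the Dieudonné determinant -/

section DieudonneDet

variable {K : Type*} [DivisionRing K]

/-! Both matrices factor as `Uᵀ * D * U` with `D` diagonal with entries `h`. For `L`, `U` is the
incidence matrix of inclusion; for `g`, it is the reversed incidence matrix with entries signed by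
`ω(z) ω(y)`. Strict inclusion changes cardinality, so `U` is unitriangular, and left multiplication
by `Uᵀ` or `U` is a sequence of row additions. Only `D` contributes, and `h` may vanish.

The main work is to show that the determinant defined by elimination respects row operations. Row
additions and scalings in size `n` make the choice of pivot irrelevant in size `n + 1`; a convenient
pivot then gives the same operations in size `n + 1`. -/

/-- The Schur complement of the top left entry. -/
def schurCompl {n : ℕ} (A : Matrix (Fin (n + 1)) (Fin (n + 1)) K) : Matrix (Fin n) (Fin n) K :=
  Matrix.of fun i j => A i.succ j.succ - A i.succ 0 * (A 0 0)⁻¹ * A 0 j.succ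

/-- The class of the sign of a permutation. -/
noncomputable def signClass (K : Type*) [DivisionRing K] {ι : Type*} [DecidableEq ι] [Fintype ι]
    (σ : Equiv.Perm ι) : WithZero (Abelianization Kˣ) :=
  abClass (((Equiv.Perm.sign σ : ℤˣ) : ℤ) : K)

theorem abClass_neg_one_mul_self :
    abClass (-1 : K) * abClass (-1 : K) = 1 := by
  rw [← map_mul, neg_mul_neg, one_mul, map_one]

section

variable {ι : Type*} [DecidableEq ι] [Fintype ι]

theorem signClass_mul (σ τ : Equiv.Perm ι) :
    signClass K (σ * τ) = signClass K σ * signClass K τ := by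
  rw [signClass, signClass, signClass, Equiv.Perm.sign_mul, Units.val_mul, Int.cast_mul, map_mul]

theorem signClass_one : signClass K (1 : Equiv.Perm ι) = 1 := by
  simp [signClass]

theorem signClass_swap {i j : ι} (hij : i ≠ j) :
    signClass K (Equiv.swap i j) = abClass (-1) := by
  simp [signClass, Equiv.Perm.sign_swap hij]

theorem signClass_mul_self (σ : Equiv.Perm ι) : signClass K σ * signClass K σ = 1 := by
  rw [signClass, ← map_mul, ← Int.cast_mul, ← Units.val_mul, Int.units_mul_self]
  simp

end

theorem dieudonneDet_of_col_zero {n : ℕ} (A : Matrix (Fin (n + 1)) (Fin (n + 1)) K)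
    (hA : ∀ i, A i 0 = 0) : dieudonneDet A = 0 := by
  rw [dieudonneDet, dif_neg]
  simpa using hA

/-- Elimination with the first nonzero entry as pivot, written as a Schur complement. -/
theorem exists_dieudonneDet_eq {n : ℕ} (A : Matrix (Fin (n + 1)) (Fin (n + 1)) K)
    (hA : ∃ i, A i 0 ≠ 0) :
    ∃ τ : Equiv.Perm (Fin (n + 1)), A (τ 0) 0 ≠ 0 ∧
      dieudonneDet A = signClass K τ * (abClass (A (τ 0) 0) *
        dieudonneDet (schurCompl (A.submatrix τ id))) := by
  classical
  rw [dieudonneDet, dif_pos hA]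
  generalize hp : Fin.find (fun i => A i 0 ≠ 0) hA = p
  have hp0 : A p 0 ≠ 0 := by
    rw [← hp]; exact Fin.find_spec hA
  refine ⟨p.cycleRange.symm, by simpa using hp0, ?_⟩
  have hs : signClass K p.cycleRange.symm = abClass ((-1) ^ (p : ℕ)) := by
    simp [signClass, Equiv.Perm.sign_symm, Fin.sign_cycleRange]
  rw [hs]
  dsimp only
  rw [map_mul, mul_assoc]
  congr 2
  · simp
  · congr 1
    ext i j
    simp [schurCompl]

/-- Multiplying a row from the left by a scalar. -/
def RowScaling (K : Type*) [DivisionRing K] (n : ℕ) : Prop :=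
  ∀ (A : Matrix (Fin n) (Fin n) K) (i : Fin n) (c : K),
    dieudonneDet (A.updateRow i (c • A i)) = abClass c * dieudonneDet A

/-- Adding a left multiple of a row to another one. -/
def RowAddition (K : Type*) [DivisionRing K] (n : ℕ) : Prop :=
  ∀ (A : Matrix (Fin n) (Fin n) K) (i j : Fin n) (c : K), i ≠ j →
    dieudonneDet (A.updateRow i (A i + c • A j)) = dieudonneDet A

/-- Permuting the rows. -/
def RowPermutation (K : Type*) [DivisionRing K] (n : ℕ) : Prop :=
  ∀ (A : Matrix (Fin n) (Fin n) K) (σ : Equiv.Perm (Fin n)),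
    dieudonneDet (A.submatrix σ id) = signClass K σ * dieudonneDet A

/-- The determinant can be computed with any pivot in the first column. -/
def PivotIndependence (K : Type*) [DivisionRing K] (n : ℕ) : Prop :=
  ∀ (A : Matrix (Fin (n + 1)) (Fin (n + 1)) K) (τ : Equiv.Perm (Fin (n + 1))), A (τ 0) 0 ≠ 0 →
    dieudonneDet A = signClass K τ * (abClass (A (τ 0) 0) *
      dieudonneDet (schurCompl (A.submatrix τ id)))

/-- Adding multiples of one row to all other rows. -/
theorem RowAddition.add_multiples {n : ℕ} (hadd : RowAddition K n)
    (A : Matrix (Fin n) (Fin n) K) (j : Fin n) (c : Fin n → K) (s : Finset (Fin n)) (hj : j ∉ s) :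
    dieudonneDet (Matrix.of fun i k => if i ∈ s then A i k + c i * A j k else A i k) =
      dieudonneDet A := by
  induction s using Finset.induction_on with
  | empty => simp only [Finset.notMem_empty, if_false]; rfl
  | insert a s ha ih =>
    rw [Finset.mem_insert, not_or] at hj
    refine Eq.trans (congrArg _ ?_) ((hadd _ a j (c a) (Ne.symm hj.1)).trans (ih hj.2))
    ext i k
    by_cases hia : i = a
    · subst hia
      simp [ha, hj.2]
    · simp [hia, Matrix.updateRow_ne]

/-- Adding a linear combination of the other rows to a row. -/
theorem RowAddition.add_sum {n : ℕ} (hadd : RowAddition K n)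
    (A : Matrix (Fin n) (Fin n) K) (i : Fin n) (c : Fin n → K) (s : Finset (Fin n)) (hi : i ∉ s) :
    dieudonneDet (A.updateRow i (A i + ∑ j ∈ s, c j • A j)) = dieudonneDet A := by
  induction s using Finset.induction_on with
  | empty => simp
  | insert a s ha ih =>
    rw [Finset.mem_insert, not_or] at hi
    refine Eq.trans (congrArg _ ?_) ((hadd _ i a (c a) hi.1).trans (ih hi.2))
    rw [Matrix.updateRow_idem, Matrix.updateRow_self, Matrix.updateRow_ne (Ne.symm hi.1),
      Finset.sum_insert ha, add_assoc, add_comm (c a • A a)]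

theorem RowAddition.rowPermutation {n : ℕ} (hadd : RowAddition K n) (hsc : RowScaling K n) :
    RowPermutation K n := by
  intro A σ
  induction σ using Equiv.Perm.swap_induction_on generalizing A with
  | one =>
    rw [signClass_one, one_mul]
    rfl
  | swap_mul σ x y hxy ih =>
    have key : ∀ B : Matrix (Fin n) (Fin n) K,
        dieudonneDet (B.submatrix (Equiv.swap x y) id) = abClass (-1) * dieudonneDet B := by
      intro B
      -- Rows `(a, b)` become `(a + b, b)`, `(a + b, -a)`, `(b, -a)`; negating the second row
      -- completes the swap.
      rw [← hadd B x y 1 hxy, ← hadd (B.updateRow x (B x + (1 : K) • B y)) y x (-1) (Ne.symm hxy),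
        ← hadd _ x y 1 hxy, ← hsc _ y]
      congr 1
      ext i k
      by_cases hy : i = y
      · subst hy
        simp [Ne.symm hxy, Matrix.updateRow_apply]
      · by_cases hx : i = x
        · subst hx
          simp [hxy, Ne.symm hxy, Matrix.updateRow_apply, add_comm]
        · simp [hx, hy, Matrix.updateRow_apply, Equiv.swap_apply_of_ne_of_ne hx hy]
    have hc : A.submatrix (Equiv.swap x y * σ) id =
        (A.submatrix (Equiv.swap x y) id).submatrix σ id := rfl
    rw [hc, ih, key, signClass_mul, signClass_swap hxy, ← mul_assoc, mul_comm (signClass K σ)]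

/-- Exchanging two possible pivots. -/
theorem dieudonneDet_schurCompl_swap {n : ℕ} (hadd : RowAddition K n) (hsc : RowScaling K n)
    (B : Matrix (Fin (n + 1)) (Fin (n + 1)) K) (p : Fin n) (h0 : B 0 0 ≠ 0)
    (hp : B p.succ 0 ≠ 0) :
    abClass (B p.succ 0) * dieudonneDet (schurCompl (B.submatrix (Equiv.swap 0 p.succ) id)) =
      abClass (-1) * (abClass (B 0 0) * dieudonneDet (schurCompl B)) := by
  -- Clearing with row `p` of the old Schur complement cancels the contribution of row `0` of `B`
  -- and gives the new complement, except that row `p` must still be scaled by `-B 0 0 * (B p.succ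
  -- 0)⁻¹`.
  rw [← hadd.add_multiples (schurCompl B) p (fun i => -(B i.succ 0 * (B p.succ 0)⁻¹))
    (Finset.univ.erase p) (by simp), ← mul_assoc (abClass (-1)), ← map_mul]
  have h1 : (-1 : K) * B 0 0 = B p.succ 0 * ((B p.succ 0)⁻¹ * (-B 0 0)) := by
    rw [mul_inv_cancel_left₀ hp]; simp
  -- The two orders agree only as classes modulo commutators.
  have h2 : abClass ((B p.succ 0)⁻¹ * (-B 0 0)) = abClass ((-B 0 0) * (B p.succ 0)⁻¹) := by
    rw [map_mul, map_mul, mul_comm]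
  rw [h1, map_mul, mul_assoc, h2, ← hsc _ p (-B 0 0 * (B p.succ 0)⁻¹)]
  refine congrArg _ (congrArg _ ?_)
  ext i k
  by_cases hi : i = p
  · subst hi
    simp [schurCompl, mul_sub, mul_assoc, h0, hp]
  · have hi' : i.succ ≠ p.succ := by simpa using hi
    simp [schurCompl, hi, Matrix.updateRow_ne, Equiv.swap_apply_of_ne_of_ne, hi', mul_sub,
      mul_assoc, hp]
    rw [sub_eq_add_neg]

theorem RowAddition.pivotIndependence {n : ℕ} (hadd : RowAddition K n) (hsc : RowScaling K n) :
    PivotIndependence K n := by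
  have hperm := hadd.rowPermutation hsc
  have key : ∀ (B : Matrix (Fin (n + 1)) (Fin (n + 1)) K) (σ : Equiv.Perm (Fin (n + 1))),
      B 0 0 ≠ 0 → B (σ 0) 0 ≠ 0 →
      signClass K σ * (abClass (B (σ 0) 0) * dieudonneDet (schurCompl (B.submatrix σ id))) =
        abClass (B 0 0) * dieudonneDet (schurCompl B) := by
    intro B σ h0 hσ
    -- `p` selects the new pivot row, while `e` merely permutes the rows of the Schur complement.
    obtain ⟨⟨p, e⟩, rfl⟩ := Equiv.Perm.decomposeFin.symm.surjective σ
    have hS : schurCompl (B.submatrix (Equiv.Perm.decomposeFin.symm (p, e)) id) =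
        (schurCompl (B.submatrix (Equiv.swap 0 p) id)).submatrix e id := by
      ext i j
      simp [schurCompl]
    rw [hS, hperm]
    simp only [Equiv.Perm.decomposeFin_symm_apply_zero] at hσ ⊢
    have hs : signClass K (Equiv.Perm.decomposeFin.symm (p, e)) * signClass K e =
        if p = 0 then 1 else abClass (-1) := by
      have he : signClass K (Equiv.Perm.decomposeFin.symm (p, e)) =
          (if p = 0 then 1 else abClass (-1)) * signClass K e := by
        rw [signClass, Equiv.Perm.decomposeFin.symm_sign, Units.val_mul, Int.cast_mul, map_mul,
          signClass]
        split_ifs <;> simp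
      rw [he, mul_assoc, signClass_mul_self, mul_one]
    rw [mul_left_comm (abClass _), ← mul_assoc, hs]
    cases p using Fin.cases with
    | zero =>
      rw [if_pos rfl, one_mul, Equiv.swap_self]
      rfl
    | succ p =>
      rw [if_neg (Fin.succ_ne_zero p), dieudonneDet_schurCompl_swap hadd hsc B p h0 hσ,
        ← mul_assoc, abClass_neg_one_mul_self, one_mul]
  intro A τ hτ
  obtain ⟨τ', hτ', h⟩ := exists_dieudonneDet_eq A ⟨_, hτ⟩
  have hkey := key (A.submatrix τ' id) (τ'⁻¹ * τ) (by simpa using hτ') (by simpa using hτ)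
  have hA : (A.submatrix τ' id).submatrix (τ'⁻¹ * τ) id = A.submatrix τ id := by
    ext; simp
  rw [hA] at hkey
  rw [h]
  simp only [Matrix.submatrix_apply, id] at hkey
  rw [← hkey, ← mul_assoc, ← signClass_mul, mul_inv_cancel_left]
  simp

/-- A scalar on the pivot row cancels against the inverse of the pivot in the Schur complement; on
any other row it passes to the corresponding row of the complement. -/
theorem PivotIndependence.rowScaling {n : ℕ} (hpiv : PivotIndependence K n)
    (hsc : RowScaling K n) : RowScaling K (n + 1) := by
  intro A i c
  by_cases hA : ∃ k, A.updateRow i (c • A i) k 0 ≠ 0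
  · obtain ⟨τ, hτ, h⟩ := exists_dieudonneDet_eq _ hA
    rw [h]
    obtain ⟨i, rfl⟩ := τ.surjective i
    cases i using Fin.cases with
    | zero =>
      simp only [Matrix.updateRow_self, Pi.smul_apply, smul_eq_mul, mul_ne_zero_iff] at hτ ⊢
      have hS : schurCompl ((A.updateRow (τ 0) (c • A (τ 0))).submatrix τ id) =
          schurCompl (A.submatrix τ id) := by
        ext k l
        simp [schurCompl, Matrix.updateRow_apply, mul_assoc, hτ.1]
      rw [hS, hpiv A τ hτ.2, map_mul, mul_assoc, mul_left_comm]
    | succ i =>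
      have hi : τ 0 ≠ τ i.succ := fun h => Fin.succ_ne_zero i (τ.injective h).symm
      rw [Matrix.updateRow_ne hi] at hτ ⊢
      have hS : schurCompl ((A.updateRow (τ i.succ) (c • A (τ i.succ))).submatrix τ id) =
          (schurCompl (A.submatrix τ id)).updateRow i (c • schurCompl (A.submatrix τ id) i) := by
        ext k l
        by_cases hk : k = i
        · subst hk
          simp [schurCompl, Matrix.updateRow_apply, mul_assoc, mul_sub, hi]
        · simp [schurCompl, Matrix.updateRow_apply, hi, hk]
      rw [hS, hsc, hpiv A τ hτ]
      ac_rfl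
  · push Not at hA
    rw [dieudonneDet_of_col_zero _ hA]
    by_cases hc : c = 0
    · simp [hc]
    · rw [dieudonneDet_of_col_zero A, mul_zero]
      intro k
      have := hA k
      by_cases hk : k = i
      · subst hk
        simpa [hc] using this
      · simpa [hk, Matrix.updateRow_ne] using this

theorem PivotIndependence.rowAddition {n : ℕ} (hpiv : PivotIndependence K n)
    (hadd : RowAddition K n) : RowAddition K (n + 1) := by
  intro A i j c hij
  -- The pivot must survive the addition: either it lies outside row `i`, or row `i` has the only
  -- nonzero entry of the first column, and then the complement does not involve row `i`.
  have key : ∀ q, A q 0 ≠ 0 → (q = i → ∀ k, k ≠ i → A k 0 = 0) →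
      dieudonneDet (A.updateRow i (A i + c • A j)) = dieudonneDet A := by
    intro q hq hqi
    obtain ⟨τ, rfl⟩ : ∃ τ : Equiv.Perm (Fin (n + 1)), τ 0 = q := ⟨Equiv.swap 0 q, by simp⟩
    have hpe : A.updateRow i (A i + c • A j) (τ 0) 0 = A (τ 0) 0 := by
      by_cases h : τ 0 = i
      · simp [h, hqi h j hij.symm]
      · rw [Matrix.updateRow_ne h]
    rw [hpiv A τ hq, hpiv _ τ (hpe.symm ▸ hq), hpe]
    refine congrArg _ (congrArg _ ?_)
    obtain ⟨i, rfl⟩ := τ.surjective i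
    obtain ⟨j, rfl⟩ := τ.surjective j
    cases i using Fin.cases with
    | zero =>
      refine congrArg _ ?_
      have hz : ∀ k : Fin n, A (τ k.succ) 0 = 0 := fun k =>
        hqi rfl _ fun h => Fin.succ_ne_zero k (τ.injective h)
      ext k l
      simp [schurCompl, Matrix.updateRow_apply, hz]
    | succ i =>
      have hi : τ 0 ≠ τ i.succ := fun h => Fin.succ_ne_zero i (τ.injective h).symm
      cases j using Fin.cases with
      -- A multiple of the pivot row is removed again by the elimination.
      | zero =>
        refine congrArg _ ?_
        ext k l
        by_cases hk : k = i
        · subst hk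
          simp [schurCompl, Matrix.updateRow_apply, hi, add_mul, mul_assoc, hq]
        · simp [schurCompl, Matrix.updateRow_apply, hi, hk]
      | succ j =>
        have hij' : i ≠ j := fun h => hij (by rw [h])
        rw [← hadd (schurCompl (A.submatrix τ id)) i j c hij']
        refine congrArg _ ?_
        ext k l
        by_cases hk : k = i
        · subst hk
          simp [schurCompl, Matrix.updateRow_apply, hi, add_mul, mul_sub, mul_assoc]
          abel
        · simp [schurCompl, Matrix.updateRow_apply, hi, hk]
  by_cases h : ∃ q, q ≠ i ∧ A q 0 ≠ 0
  · obtain ⟨q, hqi, hq⟩ := h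
    exact key q hq fun h => absurd h hqi
  · push Not at h
    by_cases hi : A i 0 = 0
    · have hA : ∀ k, A k 0 = 0 := fun k => by
        by_cases hk : k = i
        · rw [hk, hi]
        · exact h k hk
      rw [dieudonneDet_of_col_zero A hA, dieudonneDet_of_col_zero]
      intro k
      simp [Matrix.updateRow_apply, hA]
    · exact key i hi fun _ => h

theorem rowAddition_and_rowScaling (n : ℕ) : RowAddition K n ∧ RowScaling K n := by
  induction n with
  | zero => exact ⟨fun A i => i.elim0, fun A i => i.elim0⟩
  | succ n ih =>
    have hpiv := ih.1.pivotIndependence ih.2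
    exact ⟨hpiv.rowAddition ih.1, hpiv.rowScaling ih.2⟩

theorem rowAddition (n : ℕ) : RowAddition K n := (rowAddition_and_rowScaling n).1

theorem rowScaling (n : ℕ) : RowScaling K n := (rowAddition_and_rowScaling n).2

/-! ### Products with diagonal and unitriangular matrices -/

theorem dieudonneDet_one (n : ℕ) : dieudonneDet (1 : Matrix (Fin n) (Fin n) K) = 1 := by
  induction n with
  | zero => rw [dieudonneDet]
  | succ n ih =>
    have hS : schurCompl ((1 : Matrix (Fin (n + 1)) (Fin (n + 1)) K).submatrix
        (1 : Equiv.Perm (Fin (n + 1))) id) = 1 := by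
      ext i j
      simp [schurCompl, Matrix.one_apply]
    have h1 : (1 : Matrix (Fin (n + 1)) (Fin (n + 1)) K) ((1 : Equiv.Perm (Fin (n + 1))) 0) 0 = 1 :=
      Matrix.one_apply_eq 0
    rw [(rowAddition n).pivotIndependence (rowScaling n) 1 1 (h1 ▸ one_ne_zero), hS, ih, h1,
      signClass_one, map_one, one_mul, one_mul]

theorem dieudonneDet_diagonal_mul {n : ℕ} (d : Fin n → K) (A : Matrix (Fin n) (Fin n) K) :
    dieudonneDet (Matrix.diagonal d * A) = (∏ i, abClass (d i)) * dieudonneDet A := by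
  have key : ∀ s : Finset (Fin n),
      dieudonneDet (Matrix.of fun i k => if i ∈ s then d i * A i k else A i k) =
        (∏ i ∈ s, abClass (d i)) * dieudonneDet A := by
    intro s
    induction s using Finset.induction_on with
    | empty => simp only [Finset.notMem_empty, if_false, Finset.prod_empty, one_mul]; rfl
    | insert a s ha ih =>
      rw [Finset.prod_insert ha, mul_assoc, ← ih, ← rowScaling n _ a]
      congr 1
      ext i k
      by_cases hia : i = a
      · subst hia
        simp [ha]
      · simp [hia, Matrix.updateRow_ne]
  rw [← key Finset.univ]
  congr 1
  ext i k
  simp [Matrix.diagonal_mul]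

/-- Left multiplication by a matrix that is unitriangular with respect to a preorder. -/
theorem dieudonneDet_unitriangular_mul {n : ℕ} (r : Fin n → ℤ) (U : Matrix (Fin n) (Fin n) K)
    (hdiag : ∀ i, U i i = 1) (hU : ∀ i j, i ≠ j → U i j ≠ 0 → r j < r i)
    (A : Matrix (Fin n) (Fin n) K) : dieudonneDet (U * A) = dieudonneDet A := by
  have key : ∀ s : Finset (Fin n),
      dieudonneDet (Matrix.of fun i => if i ∈ s then (U * A) i else A i) = dieudonneDet A := by
    intro s
    -- Rows are replaced in decreasing order of `r`: the new row `a` only needs rows of smaller `r`,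
    -- which are still rows of `A`.
    induction s using Finset.induction_on_min_value r with
    | empty => simp only [Finset.notMem_empty, if_false]; rfl
    | insert a s ha hmin ih =>
      refine Eq.trans (congrArg _ ?_)
        (((rowAddition n).add_sum _ a (U a) (Finset.univ.erase a) (by simp)).trans ih)
      ext i k
      by_cases hia : i = a
      · subst hia
        simp only [Matrix.of_apply, Finset.mem_insert_self, if_true, Matrix.updateRow_self,
          if_neg ha, Pi.add_apply, Finset.sum_apply, Pi.smul_apply, smul_eq_mul, Matrix.mul_apply]
        rw [← Finset.add_sum_erase _ _ (Finset.mem_univ i), hdiag, one_mul]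
        congr 1
        refine Finset.sum_congr rfl fun j hj => ?_
        by_cases h0 : U i j = 0
        · simp [h0]
        · have hlt := hU i j (Finset.ne_of_mem_erase hj).symm h0
          have hjs : j ∉ s := fun hjs => absurd (hmin j hjs) (not_le.mpr hlt)
          simp [hjs]
      · simp [hia, Matrix.updateRow_ne]
  rw [← key Finset.univ]
  congr 1
  ext i k
  simp

theorem dieudonneDet_transpose_diagonal_mul {n : ℕ} (r : Fin n → ℤ)
    (U : Matrix (Fin n) (Fin n) K) (d : Fin n → K)
    (hdiag : ∀ i, U i i = 1) (hU : ∀ i j, i ≠ j → U i j ≠ 0 → r j < r i) :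
    dieudonneDet (U.transpose * (Matrix.diagonal d * U)) = ∏ i, abClass (d i) := by
  rw [dieudonneDet_unitriangular_mul (fun i => -r i) U.transpose hdiag
    (fun i j hij h => neg_lt_neg (hU j i hij.symm h)), dieudonneDet_diagonal_mul]
  -- Writing `U` as `U * 1` lets invariance under left multiplication suffice, without general
  -- multiplicativity.
  conv_lhs => rw [← mul_one U]
  rw [dieudonneDet_unitriangular_mul r U hdiag hU, dieudonneDet_one, mul_one]

end DieudonneDet

/-! ### Factorization of the connection and Green matrices -/

theorem signOmega_eq_or (K : Type*) [DivisionRing K] {α : Type*} (x : Finset α) :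
    signOmega K x = 1 ∨ signOmega K x = -1 := by
  rcases Int.even_or_odd (setDim x) with h | h
  · exact Or.inl h.neg_one_zpow
  · exact Or.inr h.neg_one_zpow

theorem signOmega_mul_self (K : Type*) [DivisionRing K] {α : Type*} (x : Finset α) :
    signOmega K x * signOmega K x = 1 := by
  rcases signOmega_eq_or K x with h | h <;> simp [h]

theorem theorem3 {α : Type*} [DecidableEq α] (G : Finset (Finset α))
    {K : Type*} [DivisionRing K] (h : G → K)
    (n : ℕ) (e : Fin n ≃ G) :
    dieudonneDet ((connectionMatrix h).submatrix e e) = ∏ x : G, abClass (h x) ∧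
      dieudonneDet ((greenMatrix h).submatrix e e) = ∏ x : G, abClass (h x) := by
  have hne : ∀ {i j : Fin n}, i ≠ j → (e i).1 ≠ (e j).1 := fun hij hE =>
    hij (e.injective (Subtype.ext hE))
  constructor
  · have hL : (connectionMatrix h).submatrix e e =
        (Matrix.of fun z y : Fin n => if (e z).1 ⊆ (e y).1 then (1 : K) else 0).transpose *
          (Matrix.diagonal (fun i => h (e i)) *
            Matrix.of fun z y : Fin n => if (e z).1 ⊆ (e y).1 then (1 : K) else 0) := by
      ext i j
      simp only [Matrix.submatrix_apply, connectionMatrix, Matrix.of_apply, chi, Wminus,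
        ← Finset.filter_and, Finset.sum_filter, Matrix.diagonal_mul,
        Matrix.mul_apply (M := Matrix.transpose _), Matrix.transpose_apply]
      rw [← e.sum_comp]
      refine Finset.sum_congr rfl fun k _ => ?_
      by_cases h1 : (e k).1 ⊆ (e i).1 <;> by_cases h2 : (e k).1 ⊆ (e j).1 <;>
        simp only [h1, h2, and_true, and_false, if_true, if_false, mul_one, one_mul, mul_zero, zero_mul]
    -- Nonzero entries go from a set to its supersets, so the rank is minus the cardinality; for the
    -- Green matrix the inclusion, and hence the sign, is reversed.
    rw [hL, dieudonneDet_transpose_diagonal_mul (fun i => -((e i).1.card : ℤ)),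
      e.prod_comp fun x => abClass (h x)]
    · simp
    · intro i j hij h0
      have hs : (e i).1 ⊆ (e j).1 := by
        by_contra hs
        simp only [Matrix.of_apply, if_neg hs, ne_eq, not_true_eq_false] at h0
      have := Finset.card_lt_card (hs.ssubset_of_ne (hne hij))
      simpa using this
  · have hg : (greenMatrix h).submatrix e e =
        (Matrix.of fun z y : Fin n => if (e y).1 ⊆ (e z).1 then
          signOmega K (e z).1 * signOmega K (e y).1 else 0).transpose *
          (Matrix.diagonal (fun i => h (e i)) *
            Matrix.of fun z y : Fin n => if (e y).1 ⊆ (e z).1 then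
              signOmega K (e z).1 * signOmega K (e y).1 else 0) := by
      ext i j
      simp only [Matrix.submatrix_apply, greenMatrix, Matrix.of_apply, chi, Wplus,
        ← Finset.filter_and, Finset.sum_filter, Matrix.diagonal_mul,
        Matrix.mul_apply (M := Matrix.transpose _), Matrix.transpose_apply]
      rw [← e.sum_comp, Finset.mul_sum]
      refine Finset.sum_congr rfl fun k _ => ?_
      by_cases h1 : (e i).1 ⊆ (e k).1 <;> by_cases h2 : (e j).1 ⊆ (e k).1 <;>
        simp only [h1, h2, and_true, and_false, if_true, if_false, mul_zero, zero_mul]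
      -- The signs are `±1`, hence commute with `h`, and the two copies of `ω(e k)` cancel.
      rcases signOmega_eq_or K (e i).1 with hi | hi <;>
        rcases signOmega_eq_or K (e j).1 with hj | hj <;>
        rcases signOmega_eq_or K (e k).1 with hk | hk <;> simp [hi, hj, hk]
    rw [hg, dieudonneDet_transpose_diagonal_mul (fun i => ((e i).1.card : ℤ)),
      e.prod_comp fun x => abClass (h x)]
    · simp [signOmega_mul_self]
    · intro i j hij h0
      have hs : (e j).1 ⊆ (e i).1 := by
        by_contra hs
        simp only [Matrix.of_apply, if_neg hs, ne_eq, not_true_eq_false] at h0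
      have := Finset.card_lt_card (hs.ssubset_of_ne (hne hij.symm))
      simpa using this
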